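/- Let $(R,\mathfrak m,k)$ be a commutative complete Noetherian local ring, let $E$ be an injective hull of $k$, and write $M^\vee=\operatorname{Hom}_R(M,E)$. Let $\mathcal A$ be the class of Artinian $R$-modules; it contains $E$. A *preradical* $\alpha$ on $\mathcal A$ assigns to each $M\in\mathcal A$ a submodule $\alpha(M)\subseteq M$ such that $g(\alpha(M))\subseteq\alpha(N)$ for every $R$-linear map $g:M\to N$ in $\mathcal A$. Its *finitistic version* is $\alpha_f(M)=\sum\{\alpha(L)\mid L\subseteq M \text{ finitely generated},\ L\in\mathcal A\}$. For $\beta\in\{\alpha,\alpha_f\}$ let $\beta^{\smallsmile}(R)=(R^\vee/\beta(R^\vee))^\vee$, regarded as an ideal of $R$ by means of the inclusion $(R^\vee/\beta(R^\vee))^\vee\subseteq R^{\vee\vee}$ and the evaluation map $R\to R^{\vee\vee}$. Let $\lambda$ denote length. Then for every preradical $\alpha$ on $\mathcal A$: \begin{align*} \alpha^{\smallsmile}(R)&=\operatorname{ann}(\alpha(E))=\bigcap_{M\in\mathcal A}\operatorname{ann}(\alpha(M))\\ &\subseteq \alpha_f^{\smallsmile}(R)=\operatorname{ann}(\alpha_f(E))=\bigcap_{\lambda(M)<\infty}\operatorname{ann}(\alpha(M))\\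 &\subseteq\bigcap_{I\text{ ideal},\ \lambda(R/I)<\infty}\operatorname{ann}(\alpha(R/I)). \end{align*} Moreover, the last containment is an equality whenever $R$ is approximately Gorenstein, i.e. every power of $\mathfrak m$ contains an irreducible $\mathfrak m$-primary ideal; this is so, for example, if $R$ is reduced or if $R$ has depth at least $2$. Finally, let $\mathrm{cl}$ be a residual closure operation on Artinian modules and on all ideals: to each submodule $L\subseteq M$, where $M$ is Artinian or $M\cong R$, it assigns a submodule $L^{\mathrm{cl}}_M$ with $L\subseteq L^{\mathrm{cl}}_M\subseteq M$, compatibly with isomorphisms, such that $L^{\mathrm{cl}}_M\subseteq N^{\mathrm{cl}}_M$ for $L\subseteq N\subseteq M$, $(L^{\mathrm{cl}}_M)^{\mathrm{cl}}_M=L^{\mathrm{cl}}_M$, and $(\ker q)^{\mathrm{cl}}_M=q^{-1}(0^{\mathrm{cl}}_P)$ for every surjection $q:M\to P$ of such modules. Write $J^{\mathrm{cl}}=J^{\mathrm{cl}}_R$ for ideals $J$. Suppose that $\alpha$ represents $\mathrm{cl}$, i.e. $\alpha(M)=0^{\mathrm{cl}}_M$ for all $M\in\mathcal A$, and that for every ideal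 $J$ of $R$ there is a collection $\{I_\lambda\}_{\lambda\in\Lambda}$ of $\mathfrak m$-primary ideals with $J=\bigcap_\lambda I_\lambda$ and $J^{\mathrm{cl}}=\bigcap_\lambda I_\lambda^{\mathrm{cl}}$ (an empty intersection being $R$). Then \[\bigcap_{\lambda(R/I)<\infty}\operatorname{ann}(\alpha(R/I))=\bigcap_{I\text{ ideal of }R}(I:I^{\mathrm{cl}}).\] -/

import Mathlib

universe u

namespace TestIdeal

section Selectors

variable (R : Type u) [CommRing R]

/-- A class of `R`-modules. -/
abbrev ModuleClass : Type (u + 1) :=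
  ∀ (M : Type u) [AddCommGroup M] [Module R M], Prop

/-- The class of Artinian `R`-modules. -/
def artinianModules : ModuleClass R := fun M _ _ => IsArtinian R M

/-- The class consisting of the Artinian `R`-modules and of `R` itself (up to isomorphism).
An operation on it acts on submodules of Artinian modules and on all ideals of `R`. -/
def artinianModulesAndRing : ModuleClass R :=
  fun M _ _ => IsArtinian R M ∨ Nonempty (M ≃ₗ[R] R)

/-- A choice of a submodule of each module. A selection "on a class `𝓜`" is represented by such a
function of which only the values on members of `𝓜` matter; all laws below are required only on
members of `𝓜`. -/
abbrev Selection : Type (u + 1) :=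
  ∀ (M : Type u) [AddCommGroup M] [Module R M], Submodule R M

/-- An assignment `(L, M) ↦ e M L` of a submodule of `M` to each submodule `L` of `M`. Again only
the values on modules `M` of the class under consideration matter. -/
abbrev PairOperation : Type (u + 1) :=
  ∀ (M : Type u) [AddCommGroup M] [Module R M], Submodule R M → Submodule R M

variable {R}

/-- `α` is a submodule selector on `𝓜`: it commutes with isomorphisms between members of `𝓜`. -/
structure IsSubmoduleSelector (𝓜 : ModuleClass R) (α : Selection R) : Prop where
  map_equiv : ∀ (M N : Type u) [AddCommGroup M] [Module R M] [AddCommGroup N] [Module R N],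
    𝓜 M → 𝓜 N → ∀ φ : M ≃ₗ[R] N, (α M).map (φ : M →ₗ[R] N) = α N

/-- `α` is a preradical on `𝓜`: a functorial submodule selector. -/
structure IsPreradical (𝓜 : ModuleClass R) (α : Selection R) : Prop
    extends IsSubmoduleSelector 𝓜 α where
  map_le : ∀ (M N : Type u) [AddCommGroup M] [Module R M] [AddCommGroup N] [Module R N],
    𝓜 M → 𝓜 N → ∀ g : M →ₗ[R] N, (α M).map g ≤ α N

/-- The finitistic version `α_f` of a selection `α` on `𝓜`: `α_f(M)` is the sum of the `α(L)`,
where `L` ranges over the finitely generated submodules of `M` that belong to `𝓜`. -/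
def finitistic (𝓜 : ModuleClass R) (α : Selection R) : Selection R :=
  fun M _ _ => ⨆ (L : Submodule R M) (_ : L.FG) (_ : 𝓜 L), (α L).map L.subtype

/-- The dual `α^⌣` of a selection `α` with respect to `(-)^∨ = Hom_R(-, E)`:
`α^⌣(M) = (M^∨ / α(M^∨))^∨`, as a submodule of `M`. The dual of the projection
`M^∨ → M^∨ / α(M^∨)` identifies `(M^∨ / α(M^∨))^∨` with a submodule of `M^∨∨`, which is pulled back
along the evaluation map `M → M^∨∨`. -/
def smileDual (E : Type u) [AddCommGroup E] [Module R E] (α : Selection R) : Selection R :=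
  fun M _ _ =>
    (LinearMap.range (LinearMap.lcomp R E (α (M →ₗ[R] E)).mkQ)).comap
      (LinearMap.applyₗ : M →ₗ[R] (M →ₗ[R] E) →ₗ[R] E)

/-- `e` is an extensive operation on the pairs `L ⊆ M` with `M` in `𝓜`. -/
structure IsExtensiveOperation (𝓜 : ModuleClass R) (e : PairOperation R) : Prop where
  le_self : ∀ (M : Type u) [AddCommGroup M] [Module R M], 𝓜 M →
    ∀ L : Submodule R M, L ≤ e M L
  map_equiv : ∀ (M N : Type u) [AddCommGroup M] [Module R M] [AddCommGroup N] [Module R N],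
    𝓜 M → 𝓜 N → ∀ (φ : M ≃ₗ[R] N) (L : Submodule R M),
      (e M L).map (φ : M →ₗ[R] N) = e N (L.map (φ : M →ₗ[R] N))

/-- `e` is a residual closure operation on the pairs `L ⊆ M` with `M` in `𝓜`: an extensive
operation that is order-preserving on submodules, idempotent and residual. -/
structure IsResidualClosure (𝓜 : ModuleClass R) (e : PairOperation R) : Prop
    extends IsExtensiveOperation 𝓜 e where
  mono : ∀ (N : Type u) [AddCommGroup N] [Module R N], 𝓜 N →
    ∀ L M : Submodule R N, L ≤ M → e N L ≤ e N M
  idem : ∀ (M : Type u) [AddCommGroup M] [Module R M], 𝓜 M →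
    ∀ L : Submodule R M, e M (e M L) = e M L
  residual : ∀ (M P : Type u) [AddCommGroup M] [Module R M] [AddCommGroup P] [Module R P],
    𝓜 M → 𝓜 P → ∀ q : M →ₗ[R] P, Function.Surjective q →
      e M (LinearMap.ker q) = (e P ⊥).comap q

/-- `α` represents the operation `e` on `𝓜`: `α(M) = 0^e_M` for all `M` in `𝓜`. -/
def Represents (𝓜 : ModuleClass R) (α : Selection R) (e : PairOperation R) : Prop :=
  ∀ (M : Type u) [AddCommGroup M] [Module R M], 𝓜 M → α M = e M ⊥

end Selectors

section Local

variable (R : Type u) [CommRing R] [IsLocalRing R]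

/-- `E`, together with `ι : k → E`, is an injective hull of the residue field `k` of `R`: `E` is an
injective `R`-module and `ι` is an essential monomorphism. -/
structure IsInjectiveHull (E : Type u) [AddCommGroup E] [Module R E]
    (ι : IsLocalRing.ResidueField R →ₗ[R] E) : Prop where
  injective_module : Module.Injective R E
  injective_map : Function.Injective ι
  essential : ∀ N : Submodule R E, N ⊓ LinearMap.range ι = ⊥ → N = ⊥

variable {R}

/-- `I` is primary to the maximal ideal of `R`. -/
def IsMPrimary (I : Ideal R) : Prop :=
  I.IsPrimary ∧ I.radical = IsLocalRing.maximalIdeal R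

variable (R)

/-- `R` is approximately Gorenstein: every power of the maximal ideal `𝔪` contains an irreducible
`𝔪`-primary ideal. -/
def IsApproximatelyGorenstein : Prop :=
  ∀ n : ℕ, ∃ I : Ideal R, I ≤ IsLocalRing.maximalIdeal R ^ n ∧ IsMPrimary I ∧ InfIrred I

/-- `R` has depth at least two: there is an `R`-regular sequence of length two in the maximal
ideal. -/
def DepthAtLeastTwo : Prop :=
  ∃ x ∈ IsLocalRing.maximalIdeal R, ∃ y ∈ IsLocalRing.maximalIdeal R,
    RingTheory.Sequence.IsRegular R [x, y]

/-- For every ideal `J` there is a collection of `𝔪`-primary ideals with intersection `J` whose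
closures have intersection the closure of `J`. -/
def HasMPrimaryApproximation (cl : PairOperation R) : Prop :=
  ∀ J : Ideal R, ∃ S : Set (Ideal R),
    (∀ I ∈ S, IsMPrimary I) ∧ J = (⨅ I ∈ S, I) ∧ cl R J = (⨅ I ∈ S, cl R I)

end Local

end TestIdeal

/-!
Matlis duality turns statements about ideals into statements about submodules of `E`: every element
of a module is detected by a map to `E`, so `α(E)` and `α_f(E)` control the annihilators of all
`α(M)`. An irreducible `𝔪`-primary ideal is the annihilator of an element `e` of `E`, and a map from
a finite-length module to `E` lands in `R e ≃ R ⧸ ann e` once `ann e` lies in a high enough power of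
`𝔪`. Conversely `R` is approximately Gorenstein as soon as `E` is locally cyclic.

To combine two `J`-torsion elements of `E` into multiples of a third, one needs elements `a`, `b`
such that the colon ideals `(J + a : b)` and `(J + b : a)` are close to `J` in the `𝔪`-adic
topology. In depth two, powers of a regular sequence do this with `J = 0`. For a prime `J` of a
complete ring with two incomparable primes above it, Krull's intersection theorem at each of these
primes and Chevalley's theorem provide `a` and `b`; if there are no such primes, then some `x ∉ J`
lies in every prime properly containing `J`, and the `J`-torsion is the union of a chain of cyclic
submodules obtained by successive division by `x`. In a reduced ring `0` is the intersection of the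
minimal primes, and local cyclicity is preserved under intersections of incomparable primes.
-/

namespace TestIdeal

open IsLocalRing Submodule
open Ideal (torsionOf)

section FiniteLength

variable {R : Type u} [CommRing R] [IsLocalRing R]

theorem isMPrimary_of_maximalIdeal_pow_le {I : Ideal R} {n : ℕ} (h : maximalIdeal R ^ n ≤ I)
    (hI : I ≠ ⊤) : IsMPrimary I := by
  have hr : I.radical = maximalIdeal R :=
    le_antisymm (le_maximalIdeal (mt Ideal.radical_eq_top.mp hI))
      fun x hx => ⟨n, h (Ideal.pow_mem_pow hx n)⟩
  exact ⟨Ideal.isPrimary_of_isMaximal_radical (hr ▸ maximalIdeal.isMaximal R), hr⟩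

theorem exists_notMem_forall_mul_mem {I : Ideal R} {n : ℕ} (h : maximalIdeal R ^ n ≤ I)
    (hI : I ≠ ⊤) : ∃ s ∉ I, ∀ r ∈ maximalIdeal R, r * s ∈ I := by
  induction n with
  | zero => exact absurd (top_le_iff.mp (by simpa using h)) hI
  | succ n ih =>
    by_cases hn : maximalIdeal R ^ n ≤ I
    · exact ih hn
    obtain ⟨s, hs, hsI⟩ := Set.not_subset.mp hn
    exact ⟨s, hsI, fun r hr => h (pow_succ' (maximalIdeal R) n ▸ Ideal.mul_mem_mul hr hs)⟩

variable [IsNoetherianRing R]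

theorem isFiniteLength_quotient_of_maximalIdeal_pow_le {I : Ideal R} {n : ℕ}
    (h : maximalIdeal R ^ n ≤ I) : IsFiniteLength R (R ⧸ I) := by
  by_cases hI : I = ⊤
  · have : Subsingleton (R ⧸ I) := Ideal.Quotient.subsingleton_iff.mpr hI
    exact .of_subsingleton
  have hm : maximalIdeal R ∈ I.minimalPrimes :=
    ⟨⟨inferInstance, le_maximalIdeal hI⟩,
      fun Q ⟨_, hIQ⟩ _ => Ideal.IsPrime.le_of_pow_le (h.trans hIQ)⟩
  have hl := (isArtinianRing_iff_isFiniteLength (R ⧸ I)).mp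
    (quotient_artinian_of_mem_minimalPrimes_of_isLocalRing I hm)
  rw [← Module.length_ne_top_iff] at hl ⊢
  rwa [Module.length_eq_of_surjective (S := R) (R := R ⧸ I) Ideal.Quotient.mk_surjective]

theorem IsMPrimary.exists_maximalIdeal_pow_le {I : Ideal R} (h : IsMPrimary I) :
    ∃ n, maximalIdeal R ^ n ≤ I :=
  h.2 ▸ I.exists_radical_pow_le_of_fg (IsNoetherian.noetherian _)

theorem IsMPrimary.isFiniteLength {I : Ideal R} (h : IsMPrimary I) :
    IsFiniteLength R (R ⧸ I) :=
  isFiniteLength_quotient_of_maximalIdeal_pow_le h.exists_maximalIdeal_pow_le.choose_spec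

end FiniteLength

section Injective

variable {R : Type u} [CommRing R] {E : Type u} [AddCommGroup E] [Module R E]

theorem mem_torsionBySet_ideal_iff {I : Ideal R} {e : E} :
    e ∈ torsionBySet R E (I : Set R) ↔ ∀ a ∈ I, a • e = 0 := by
  rw [mem_torsionBySet_iff, Subtype.forall]
  rfl

theorem torsionBySet_ideal_antitone :
    Antitone fun I : Ideal R => torsionBySet R E (I : Set R) :=
  fun _ _ h => torsionBySet_le_torsionBySet_of_subset h

theorem torsionBySet_ideal_sup (I J : Ideal R) :
    torsionBySet R E ((I ⊔ J : Ideal R) : Set R) =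
      torsionBySet R E (I : Set R) ⊓ torsionBySet R E (J : Set R) :=
  (torsion_gc R E).u_inf (b₁ := OrderDual.toDual I) (b₂ := OrderDual.toDual J)

theorem apply_quotient_mk {I : Ideal R} (f : (R ⧸ I) →ₗ[R] E) (a : R) :
    f (Ideal.Quotient.mk I a) = a • f 1 := by
  rw [← map_smul, Algebra.smul_def, mul_one, Ideal.Quotient.algebraMap_eq]

/-- The identification of `Hom(R ⧸ I, E)` with the elements of `E` annihilated by `I`, through the
value at `1`. -/
noncomputable def homQuotientEquiv (E : Type u) [AddCommGroup E] [Module R E] (I : Ideal R) :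
    ((R ⧸ I) →ₗ[R] E) ≃ₗ[R] torsionBySet R E (I : Set R) where
  toFun f := ⟨f 1, mem_torsionBySet_ideal_iff.mpr fun a ha => by
    rw [← apply_quotient_mk, Ideal.Quotient.eq_zero_iff_mem.mpr ha, map_zero]⟩
  map_add' _ _ := rfl
  map_smul' _ _ := rfl
  invFun e := I.liftQ (LinearMap.toSpanSingleton R E e) (mem_torsionBySet_ideal_iff.mp e.2)
  left_inv f := by ext; exact one_smul R (f 1)
  right_inv e := Subtype.ext (one_smul R (e : E))

variable [Module.Injective R E]

theorem exists_linearMap_apply_eq {M : Type u} [AddCommGroup M] [Module R M] {x : M} {e : E}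
    (h : torsionOf R M x ≤ torsionOf R E e) : ∃ f : M →ₗ[R] E, f x = e := by
  obtain ⟨f, hf⟩ := Module.Injective.extension_property R E _ _ (R ∙ x).subtype
    (R ∙ x).injective_subtype
    ((torsionOf R M x).liftQ (LinearMap.toSpanSingleton R E e) h ∘ₗ
      (Ideal.quotTorsionOfEquivSpanSingleton R M x).symm.toLinearMap)
  have hx : (Ideal.quotTorsionOfEquivSpanSingleton R M x).symm ⟨x, mem_span_singleton_self x⟩ =
      Submodule.Quotient.mk 1 := by
    rw [LinearEquiv.symm_apply_eq, Ideal.quotTorsionOfEquivSpanSingleton_apply_mk, one_smul]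
  exact ⟨f, (LinearMap.congr_fun hf ⟨x, mem_span_singleton_self x⟩).trans <|
    (congrArg _ hx).trans (one_smul R e)⟩

theorem exists_mem_torsionBySet_smul_eq {J : Ideal R} {a : R} {e : E}
    (h : J.colon {a} ≤ torsionOf R E e) :
    ∃ z ∈ torsionBySet R E (J : Set R), a • z = e := by
  obtain ⟨f, hf⟩ := exists_linearMap_apply_eq (x := Ideal.Quotient.mk J a) (e := e) <|
    le_trans (fun r hr => mem_colon_singleton.mpr <|
      (Submodule.Quotient.mk_eq_zero J).mp hr) h
  exact ⟨f 1, (homQuotientEquiv E J f).2, (apply_quotient_mk f a).symm.trans hf⟩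

end Injective

namespace IsInjectiveHull

variable {R : Type u} [CommRing R] [IsLocalRing R]
  {E : Type u} [AddCommGroup E] [Module R E] {ι : ResidueField R →ₗ[R] E}

theorem map_one_ne_zero (hE : IsInjectiveHull R E ι) : ι 1 ≠ 0 :=
  (map_ne_zero_iff ι hE.injective_map).mpr one_ne_zero

theorem torsionOf_map_one (hE : IsInjectiveHull R E ι) :
    torsionOf R E (ι 1) = maximalIdeal R := by
  ext r
  rw [Ideal.mem_torsionOf_iff, ← map_smul, map_eq_zero_iff ι hE.injective_map,
    Algebra.smul_def, mul_one]
  exact residue_eq_zero_iff r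

theorem range_eq_span_singleton : LinearMap.range ι = R ∙ ι 1 := by
  have h : (⊤ : Submodule R (ResidueField R)) = R ∙ 1 := eq_comm.mp <| eq_top_iff'.mpr fun z => by
    obtain ⟨r, rfl⟩ := residue_surjective z
    exact mem_span_singleton.mpr ⟨r, by rw [Algebra.smul_def, mul_one]; rfl⟩
  rw [LinearMap.range_eq_map, h, map_span, Set.image_singleton]

theorem map_one_mem (hE : IsInjectiveHull R E ι) {N : Submodule R E} (hN : N ≠ ⊥) : ι 1 ∈ N := by
  obtain ⟨e, ⟨heN, heι⟩, h0⟩ := (Submodule.ne_bot_iff _).mp (mt (hE.essential N) hN)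
  obtain ⟨r, rfl⟩ := mem_span_singleton.mp (range_eq_span_singleton.le heι)
  have hr : r ∉ maximalIdeal R := hE.torsionOf_map_one ▸ h0
  exact (N.smul_mem_iff_of_isUnit (notMem_maximalIdeal.mp hr)).mp heN

theorem torsionBySet_maximalIdeal (hE : IsInjectiveHull R E ι) :
    torsionBySet R E (maximalIdeal R : Set R) = LinearMap.range ι := by
  rw [range_eq_span_singleton]
  refine le_antisymm (fun e he => ?_) ((span_singleton_le_iff_mem _ _).mpr <|
    mem_torsionBySet_ideal_iff.mpr hE.torsionOf_map_one.ge)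
  by_cases he0 : e = 0
  · exact he0 ▸ zero_mem _
  obtain ⟨r, hr⟩ := mem_span_singleton.mp <| hE.map_one_mem (mt span_singleton_eq_bot.mp he0)
  have hu : IsUnit r := notMem_maximalIdeal.mp fun hrm =>
    hE.map_one_ne_zero (hr ▸ mem_torsionBySet_ideal_iff.mp he r hrm)
  exact ((R ∙ ι 1).smul_mem_iff_of_isUnit hu).mp (hr ▸ mem_span_singleton_self _)

theorem exists_linearMap_apply_ne_zero (hE : IsInjectiveHull R E ι) {M : Type u} [AddCommGroup M]
    [Module R M] {x : M} (hx : x ≠ 0) : ∃ f : M →ₗ[R] E, f x ≠ 0 := by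
  have := hE.injective_module
  obtain ⟨f, hf⟩ := exists_linearMap_apply_eq (x := x) (e := ι 1) <|
    hE.torsionOf_map_one ▸ le_maximalIdeal (mt (Ideal.torsionOf_eq_top_iff R x).mp hx)
  exact ⟨f, hf ▸ hE.map_one_ne_zero⟩

theorem annihilator_torsionBySet (hE : IsInjectiveHull R E ι) (I : Ideal R) :
    (torsionBySet R E (I : Set R)).annihilator = I := by
  refine le_antisymm (fun r hr => ?_) fun r hr => mem_annihilator.mpr fun e he =>
    mem_torsionBySet_ideal_iff.mp he r hr
  by_contra hrI
  obtain ⟨f, hf⟩ := hE.exists_linearMap_apply_ne_zero <|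
    mt (Ideal.Quotient.eq_zero_iff_mem (I := I)).mp hrI
  exact hf <| (apply_quotient_mk f r).trans <|
    mem_annihilator.mp hr _ (homQuotientEquiv E I f).2

theorem length_linearMap_eq_one (hE : IsInjectiveHull R E ι) {S : Type u} [AddCommGroup S]
    [Module R S] [IsSimpleModule R S] : Module.length R (S →ₗ[R] E) = 1 := by
  obtain ⟨I, hI, ⟨φ⟩⟩ := isSimpleModule_iff_quot_maximal.mp ‹IsSimpleModule R S›
  obtain rfl := IsLocalRing.eq_maximalIdeal hI
  have : IsSimpleModule R (ResidueField R) :=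
    isSimpleModule_iff_quot_maximal.mpr ⟨_, hI, ⟨LinearEquiv.refl R _⟩⟩
  rw [(LinearEquiv.congrLeft E R φ).length_eq, (homQuotientEquiv E _).length_eq,
    hE.torsionBySet_maximalIdeal, ← (LinearEquiv.ofInjective ι hE.injective_map).length_eq,
    Module.length_eq_one]

theorem length_linearMap (hE : IsInjectiveHull R E ι) {M : Type u} [AddCommGroup M] [Module R M]
    (hM : IsFiniteLength R M) : Module.length R (M →ₗ[R] E) = Module.length R M := by
  induction hM with
  | @of_subsingleton M _ _ _ =>
    rw [Module.length_eq_zero, Module.length_eq_zero]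
  | @of_simple_quotient M _ _ N _ _ ih =>
    have := hE.injective_module
    have hexact := LinearMap.exact_subtype_mkQ N
    rw [Module.length_eq_add_of_exact N.subtype N.mkQ N.injective_subtype N.mkQ_surjective hexact,
      Module.length_eq_add_of_exact (LinearMap.lcomp R E N.mkQ) (LinearMap.lcomp R E N.subtype)
        (LinearMap.lcomp_injective_of_surjective _ N.mkQ_surjective)
        (Module.Injective.extension_property R E _ _ _ N.injective_subtype)
        (LinearMap.exact_lcomp_of_exact_of_surjective E hexact N.mkQ_surjective),
      hE.length_linearMap_eq_one, ih, Module.length_eq_one R (M ⧸ N), add_comm]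

theorem length_torsionBySet (hE : IsInjectiveHull R E ι) {I : Ideal R}
    (hI : IsFiniteLength R (R ⧸ I)) :
    Module.length R (torsionBySet R E (I : Set R)) = Module.length R (R ⧸ I) := by
  rw [← (homQuotientEquiv E I).length_eq, hE.length_linearMap hI]

theorem isFiniteLength_torsionBySet (hE : IsInjectiveHull R E ι) {I : Ideal R}
    (hI : IsFiniteLength R (R ⧸ I)) : IsFiniteLength R (torsionBySet R E (I : Set R)) := by
  rwa [← Module.length_ne_top_iff, hE.length_torsionBySet hI, Module.length_ne_top_iff]

variable [IsNoetherianRing R]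

theorem exists_mem_torsionBySet_maximalIdeal_pow (hE : IsInjectiveHull R E ι) (e : E) :
    ∃ n, e ∈ torsionBySet R E ((maximalIdeal R ^ n : Ideal R) : Set R) := by
  by_contra! h
  have hmem (n : ℕ) : ι 1 ∈ maximalIdeal R ^ n • (R ∙ e) := hE.map_one_mem fun h0 =>
    h n <| mem_torsionBySet_ideal_iff.mpr fun r hr => (eq_bot_iff.mp h0) <|
      smul_mem_smul hr (mem_span_singleton_self e)
  have h1 : ι 1 ∈ R ∙ e := smul_le_right (hmem 0)
  have hKrull : (⟨ι 1, h1⟩ : R ∙ e) ∈ (⨅ n : ℕ, maximalIdeal R ^ n • ⊤ : Submodule R (R ∙ e)) :=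
    (mem_iInf _).mpr fun n => by
      obtain ⟨z, hz, hz1⟩ : ι 1 ∈ (maximalIdeal R ^ n • (⊤ : Submodule R (R ∙ e))).map
          (R ∙ e).subtype := by
        rw [map_smul'', map_subtype_top]
        exact hmem n
      exact (Subtype.ext hz1 : z = ⟨ι 1, h1⟩) ▸ hz
  rw [Ideal.iInf_pow_smul_eq_bot_of_isLocalRing _ (maximalIdeal.isMaximal R).ne_top] at hKrull
  exact hE.map_one_ne_zero (congrArg Subtype.val ((mem_bot R).mp hKrull))

end IsInjectiveHull

section Artinian

theorem exists_forall_stabilizes {α : Type*} [PartialOrder α] [WellFoundedGT α]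
    {T : ℕ → ℕ → α} (hl : ∀ i, Monotone (T · i)) (hr : ∀ n, Monotone (T n)) :
    ∃ i₀, ∀ n i, i₀ ≤ i → T n i = T n i₀ := by
  choose k hk using fun n => WellFoundedGT.monotone_chain_condition ⟨T n, hr n⟩
  obtain ⟨N, hN⟩ := WellFoundedGT.monotone_chain_condition
    ⟨fun n => T n n, fun m n h => (hl m h).trans (hr n h)⟩
  have hk' {n i : ℕ} (hi : (Finset.range N).sup k ⊔ N ≤ i) : T n i = T n (k n ⊔ N) := by
    by_cases hn : n < N
    · have hki : k n ≤ i :=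
        (Finset.le_sup (Finset.mem_range.mpr hn)).trans (le_sup_left.trans hi)
      exact (hk n i hki).symm.trans (hk n _ le_sup_left)
    · have hconst {j : ℕ} (hj : N ≤ j) : T n j = T N N :=
        le_antisymm
          ((hl j (le_max_left n j)).trans ((hr _ (le_max_right n j)).trans
            (hN _ (hj.trans (le_max_right n j))).ge))
          ((hl N (not_lt.mp hn)).trans (hr n hj))
      rw [hconst (le_sup_right.trans hi), hconst le_sup_right]
  exact ⟨_, fun n i hi => (hk' hi).trans (hk' le_rfl).symm⟩

variable {R M : Type*} [CommRing R] [AddCommGroup M] [Module R M]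

theorem le_of_forall_map_pow_inf_torsionBy_le {x : R} (hx : ∀ m : M, ∃ n : ℕ, x ^ n • m = 0)
    {N N' : Submodule R M} (hN : N ≤ N')
    (h : ∀ n, N'.map (LinearMap.lsmul R M (x ^ n)) ⊓ torsionBy R M x ≤
      N.map (LinearMap.lsmul R M (x ^ n))) : N' ≤ N := by
  intro y hy
  obtain ⟨n, hn⟩ := hx y
  induction n generalizing y with
  | zero => rw [show y = 0 by simpa using hn]; exact zero_mem N
  | succ n ih =>
    obtain ⟨y', hy', hyy'⟩ := h n ⟨mem_map_of_mem hy, show x • x ^ n • y = 0 by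
      rw [smul_smul, ← pow_succ', hn]⟩
    have hdiff : y - y' ∈ N := ih (sub_mem hy (hN hy')) <| by
      rw [smul_sub, sub_eq_zero]
      exact hyy'.symm
    exact (sub_mem_iff_left N hy').mp hdiff

theorem isArtinian_of_isArtinian_torsionBy {x : R} (hx : ∀ m : M, ∃ n : ℕ, x ^ n • m = 0)
    [IsArtinian R (torsionBy R M x)] : IsArtinian R M := by
  rw [← monotone_stabilizes_iff_artinian]
  intro f
  let N (i : ℕ) : Submodule R M := OrderDual.ofDual (f i)
  let T (n i : ℕ) : Submodule R (torsionBy R M x) :=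
    ((N i).map (LinearMap.lsmul R M (x ^ n))).comap (torsionBy R M x).subtype
  have hl (i : ℕ) : Antitone (T · i) := fun m n hmn => comap_mono <| by
    rintro _ ⟨y, hy, rfl⟩
    refine ⟨x ^ (n - m) • y, (N i).smul_mem _ hy, ?_⟩
    rw [LinearMap.lsmul_apply, smul_smul, ← pow_add, Nat.add_sub_cancel' hmn, LinearMap.lsmul_apply]
  have hr (n : ℕ) : Antitone (T n) := fun i j hij => comap_mono (map_mono (f.monotone hij))
  obtain ⟨i₀, hi₀⟩ := exists_forall_stabilizes (α := (Submodule R (torsionBy R M x))ᵒᵈ)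
    (T := fun n i => OrderDual.toDual (T n i)) hl hr
  refine ⟨i₀, fun i hi => le_antisymm (f.monotone hi) ?_⟩
  refine le_of_forall_map_pow_inf_torsionBy_le (N' := N i₀) hx (f.monotone hi) fun n z hz => ?_
  exact (hi₀ n i hi).le (show (⟨z, hz.2⟩ : torsionBy R M x) ∈ T n i₀ from hz.1)

theorem isArtinian_of_isArtinian_torsionBySet {s : Finset R}
    (hs : ∀ x ∈ s, ∀ m : M, ∃ n : ℕ, x ^ n • m = 0)
    (h : IsArtinian R (torsionBySet R M (s : Set R))) : IsArtinian R M := by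
  classical
  induction s using Finset.induction_on with
  | empty =>
    have htop : torsionBySet R M ((∅ : Finset R) : Set R) = ⊤ := by simp [eq_top_iff']
    rw [htop] at h
    exact isArtinian_of_linearEquiv topEquiv
  | insert x s _ ih =>
    refine ih (fun y hy => hs y (Finset.mem_insert_of_mem hy)) ?_
    have hx (m : torsionBySet R M (s : Set R)) : ∃ n : ℕ, x ^ n • m = 0 :=
      (hs x (Finset.mem_insert_self x s) m).imp fun n hn => Subtype.ext hn
    let j : torsionBy R (torsionBySet R M (s : Set R)) x →ₗ[R] M :=
      Submodule.subtype _ ∘ₗ Submodule.subtype _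
    have hj (m) : j m ∈ torsionBySet R M ((insert x s : Finset R) : Set R) := by
      rw [mem_torsionBySet_iff]
      rintro ⟨y, hy⟩
      obtain rfl | hy := Finset.mem_insert.mp hy
      · exact congrArg Subtype.val m.2
      · exact (mem_torsionBySet_iff _ _).mp m.1.2 ⟨y, hy⟩
    have hj_inj : Function.Injective (j.codRestrict _ hj) := by
      rw [← LinearMap.ker_eq_bot, LinearMap.ker_codRestrict, LinearMap.ker_eq_bot]
      exact Subtype.val_injective.comp Subtype.val_injective
    have := isArtinian_of_injective _ hj_inj
    exact isArtinian_of_isArtinian_torsionBy hx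

theorem IsInjectiveHull.isArtinian {R : Type u} [CommRing R] [IsLocalRing R] [IsNoetherianRing R]
    {E : Type u} [AddCommGroup E] [Module R E] {ι : ResidueField R →ₗ[R] E}
    (hE : IsInjectiveHull R E ι) : IsArtinian R E := by
  obtain ⟨s, hs : Ideal.span _ = _⟩ := (maximalIdeal R).fg_of_isNoetherianRing
  refine isArtinian_of_isArtinian_torsionBySet (s := s) (fun x hx e => ?_) ?_
  · obtain ⟨n, hn⟩ := hE.exists_mem_torsionBySet_maximalIdeal_pow e
    exact ⟨n, mem_torsionBySet_ideal_iff.mp hn _ <|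
      Ideal.pow_mem_pow (hs ▸ Ideal.subset_span hx) n⟩
  · have : IsArtinian R (ResidueField R) :=
      isArtinian_of_surjective_algebraMap residue_surjective
    rw [torsionBySet_eq_torsionBySet_span, hs, hE.torsionBySet_maximalIdeal]
    infer_instance

end Artinian

section Preradical

variable {R : Type u} [CommRing R]

theorem IsPreradical.apply_mem {𝓜 : ModuleClass R} {α : Selection R} (hα : IsPreradical 𝓜 α)
    {M N : Type u} [AddCommGroup M] [Module R M] [AddCommGroup N] [Module R N]
    (hM : 𝓜 M) (hN : 𝓜 N) (g : M →ₗ[R] N) {x : M} (hx : x ∈ α M) : g x ∈ α N :=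
  hα.map_le M N hM hN g (mem_map_of_mem hx)

theorem isSubmoduleSelector_of_map_le {𝓜 : ModuleClass R} {α : Selection R}
    (h : ∀ (M N : Type u) [AddCommGroup M] [Module R M] [AddCommGroup N] [Module R N],
      𝓜 M → 𝓜 N → ∀ g : M →ₗ[R] N, (α M).map g ≤ α N) : IsSubmoduleSelector 𝓜 α where
  map_equiv M N _ _ _ _ hM hN φ := le_antisymm (h M N hM hN φ) fun x hx =>
    ⟨φ.symm x, h N M hN hM φ.symm (mem_map_of_mem hx), φ.apply_symm_apply x⟩

theorem IsPreradical.map_le_finitistic {α : Selection R}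
    (hα : IsPreradical (artinianModules R) α) {L N : Type u} [AddCommGroup L] [Module R L]
    [AddCommGroup N] [Module R N] [Module.Finite R L] [hL : IsArtinian R L] (f : L →ₗ[R] N) :
    (α L).map f ≤ finitistic (artinianModules R) α N := by
  have hA : IsArtinian R (LinearMap.range f) := inferInstance
  rintro _ ⟨x, hx, rfl⟩
  exact mem_iSup_of_mem (LinearMap.range f) <|
    mem_iSup_of_mem (Module.Finite.iff_fg.mp inferInstance) <|
      mem_iSup_of_mem hA ⟨f.rangeRestrict x, hα.apply_mem hL hA f.rangeRestrict hx, rfl⟩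

theorem IsPreradical.finitistic {α : Selection R} (hα : IsPreradical (artinianModules R) α) :
    IsPreradical (artinianModules R) (finitistic (artinianModules R) α) := by
  have map_le (M N : Type u) [AddCommGroup M] [Module R M] [AddCommGroup N] [Module R N]
      (g : M →ₗ[R] N) : (TestIdeal.finitistic (artinianModules R) α M).map g ≤
        TestIdeal.finitistic (artinianModules R) α N := by
    simp only [TestIdeal.finitistic, Submodule.map_iSup, ← Submodule.map_comp]
    refine iSup_le fun L => iSup_le fun hfg => iSup_le fun hL => ?_
    have : Module.Finite R L := Module.Finite.iff_fg.mpr hfg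
    have : IsArtinian R L := hL
    exact hα.map_le_finitistic (g ∘ₗ L.subtype)
  exact ⟨isSubmoduleSelector_of_map_le fun M N _ _ _ _ _ _ => map_le M N,
    fun M N _ _ _ _ _ _ => map_le M N⟩

theorem IsPreradical.finitistic_le {𝓜 : ModuleClass R} {α : Selection R} (hα : IsPreradical 𝓜 α)
    {M : Type u} [AddCommGroup M] [Module R M] (hM : 𝓜 M) :
    TestIdeal.finitistic 𝓜 α M ≤ α M :=
  iSup_le fun L => iSup_le fun _ => iSup_le fun hL => hα.map_le L M hL hM L.subtype

theorem mem_smileDual_iff {E : Type u} [AddCommGroup E] [Module R E] {α : Selection R}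
    {M : Type u} [AddCommGroup M] [Module R M] {x : M} :
    x ∈ smileDual E α M ↔ ∀ f ∈ α (M →ₗ[R] E), f x = 0 := by
  constructor
  · rintro ⟨g, hg⟩ f hf
    have hgf : g ((α (M →ₗ[R] E)).mkQ f) = f x := LinearMap.congr_fun hg f
    rw [← hgf, mkQ_apply, (Submodule.Quotient.mk_eq_zero _).mpr hf, map_zero]
  · intro h
    exact ⟨(α (M →ₗ[R] E)).liftQ (LinearMap.applyₗ x) h, by ext; rfl⟩

theorem IsSubmoduleSelector.smileDual_eq_annihilator {𝓜 : ModuleClass R} {α : Selection R}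
    (hα : IsSubmoduleSelector 𝓜 α) {E : Type u} [AddCommGroup E] [Module R E]
    (hRE : 𝓜 (R →ₗ[R] E)) (hE : 𝓜 E) : smileDual E α R = (α E).annihilator := by
  ext r
  have hφ (f : R →ₗ[R] E) : r • LinearMap.ringLmapEquivSelf R R E f = f r := by
    rw [LinearMap.ringLmapEquivSelf_apply, ← map_smul, smul_eq_mul, mul_one]
  rw [mem_smileDual_iff, mem_annihilator,
    ← hα.map_equiv _ _ hRE hE (LinearMap.ringLmapEquivSelf R R E)]
  constructor
  · rintro h _ ⟨f, hf, rfl⟩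
    exact (hφ f).trans (h f hf)
  · exact fun h f hf => (hφ f).symm.trans (h _ (mem_map_of_mem hf))

end Preradical

section Annihilators

theorem iInf_annihilator_le_iInf_annihilator_quotient {R : Type u} [CommRing R]
    (α : Selection R) :
    (⨅ (M : Type u) (_ : AddCommGroup M) (_ : Module R M) (_ : IsFiniteLength R M),
      (α M).annihilator) ≤
    ⨅ (I : Ideal R) (_ : IsFiniteLength R (R ⧸ I)), (α (R ⧸ I)).annihilator :=
  le_iInf fun I => le_iInf fun hI =>
    iInf_le_of_le (R ⧸ I) <| iInf_le_of_le _ <| iInf_le_of_le _ <| iInf_le _ hI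

namespace IsInjectiveHull

variable {R : Type u} [CommRing R] [IsLocalRing R]
  {E : Type u} [AddCommGroup E] [Module R E] {ι : ResidueField R →ₗ[R] E} {α : Selection R}

theorem mem_annihilator_of_forall_smul_apply (hE : IsInjectiveHull R E ι)
    {M : Type u} [AddCommGroup M] [Module R M] {N : Submodule R M} {r : R}
    (h : ∀ f : M →ₗ[R] E, ∀ x ∈ N, r • f x = 0) : r ∈ N.annihilator := by
  refine mem_annihilator.mpr fun x hx => ?_
  by_contra h0
  obtain ⟨f, hf⟩ := hE.exists_linearMap_apply_ne_zero h0
  exact hf ((map_smul f r x).trans (h f x hx))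

theorem annihilator_eq_iInf_annihilator (hE : IsInjectiveHull R E ι) {𝓜 : ModuleClass R}
    (hα : IsPreradical 𝓜 α) (hEA : 𝓜 E) :
    (α E).annihilator = ⨅ (M : Type u) (_ : AddCommGroup M) (_ : Module R M) (_ : 𝓜 M),
      (α M).annihilator :=
  le_antisymm
    (le_iInf fun _ => le_iInf fun _ => le_iInf fun _ => le_iInf fun hM _ hr =>
      hE.mem_annihilator_of_forall_smul_apply fun f _ hx =>
        mem_annihilator.mp hr _ (hα.apply_mem hM hEA f hx))
    (iInf_le_of_le E <| iInf_le_of_le _ <| iInf_le_of_le _ <| iInf_le _ hEA)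

theorem annihilator_finitistic_eq_iInf_annihilator [IsNoetherianRing R]
    (hE : IsInjectiveHull R E ι) (hα : IsPreradical (artinianModules R) α) :
    (finitistic (artinianModules R) α E).annihilator =
      ⨅ (M : Type u) (_ : AddCommGroup M) (_ : Module R M) (_ : IsFiniteLength R M),
        (α M).annihilator := by
  refine le_antisymm (le_iInf fun _ => le_iInf fun _ => le_iInf fun _ => le_iInf fun hM _ hr =>
    hE.mem_annihilator_of_forall_smul_apply fun f x hx => mem_annihilator.mp hr _ ?_) ?_
  · obtain ⟨_, _⟩ := isFiniteLength_iff_isNoetherian_isArtinian.mp hM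
    exact hα.map_le_finitistic f (mem_map_of_mem hx)
  · simp only [finitistic, annihilator_iSup]
    refine le_iInf fun L => le_iInf fun hfg => le_iInf fun hL => ?_
    have : Module.Finite R L := Module.Finite.iff_fg.mpr hfg
    rw [show ((α L).map L.subtype).annihilator = (α L).annihilator from
      (equivMapOfInjective _ L.injective_subtype (α L)).symm.annihilator_eq]
    exact iInf_le_of_le L <| iInf_le_of_le _ <| iInf_le_of_le _ <|
      iInf_le _ (isFiniteLength_iff_isNoetherian_isArtinian.mpr ⟨inferInstance, hL⟩)

end IsInjectiveHull

end Annihilators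

section ApproximatelyGorenstein

namespace IsInjectiveHull

variable {R : Type u} [CommRing R] [IsLocalRing R]
  {E : Type u} [AddCommGroup E] [Module R E] {ι : ResidueField R →ₗ[R] E}

theorem torsionBySet_torsionOf_eq_span_singleton (hE : IsInjectiveHull R E ι) {e : E}
    (he : IsFiniteLength R (R ⧸ torsionOf R E e)) :
    torsionBySet R E (torsionOf R E e : Set R) = R ∙ e := by
  set T := torsionBySet R E (torsionOf R E e : Set R)
  have hle : R ∙ e ≤ T :=
    (span_singleton_le_iff_mem _ _).mpr <| mem_torsionBySet_ideal_iff.mpr fun _ ha => ha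
  have hlen : Module.length R (R ∙ e) = Module.length R T := by
    rw [hE.length_torsionBySet he, (Ideal.quotTorsionOfEquivSpanSingleton R E e).length_eq]
  obtain ⟨_, _⟩ := isFiniteLength_iff_isNoetherian_isArtinian.mp (hE.isFiniteLength_torsionBySet he)
  refine le_antisymm (comap_subtype_eq_top.mp ?_) hle
  by_contra hne
  exact (length_lt hne).ne ((comapSubtypeEquivOfLe hle).length_eq.trans hlen)

variable [IsNoetherianRing R]

theorem exists_torsionOf_eq_of_infIrred (hE : IsInjectiveHull R E ι) {I : Ideal R}
    (hI : IsMPrimary I) (hirr : InfIrred I) : ∃ e : E, torsionOf R E e = I := by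
  have := hE.injective_module
  obtain ⟨n, hn⟩ := hI.exists_maximalIdeal_pow_le
  obtain ⟨s, hs, hsm⟩ := exists_notMem_forall_mul_mem hn hI.1.1
  obtain ⟨e, he, hse⟩ : ∃ e ∈ torsionBySet R E (I : Set R), s • e = ι 1 :=
    exists_mem_torsionBySet_smul_eq <| by
      rw [hE.torsionOf_map_one]
      exact le_maximalIdeal fun h => hs <| by simpa using h.ge (x := (1 : R)) trivial
  have hIe : I ≤ torsionOf R E e := fun a ha => mem_torsionBySet_ideal_iff.mp he a ha
  have hinf : torsionOf R E e ⊓ (I ⊔ Ideal.span {s}) = I := by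
    refine le_antisymm ?_ (le_inf hIe le_sup_left)
    rintro a ⟨hae, ha⟩
    obtain ⟨i, hi, z, hz, rfl⟩ := mem_sup.mp ha
    obtain ⟨c, rfl⟩ := Ideal.mem_span_singleton'.mp hz
    have hcs : (c * s) • e = 0 := ((torsionOf R E e).add_mem_iff_right (hIe hi)).mp hae
    rw [mul_smul, hse] at hcs
    exact I.add_mem hi (hsm c (hE.torsionOf_map_one.le hcs))
  refine ⟨e, (hirr.2 hinf).resolve_right fun h => hs ?_⟩
  exact h.le (Ideal.mem_sup_right (Ideal.mem_span_singleton_self s))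

theorem exists_maximalIdeal_pow_range_le (hE : IsInjectiveHull R E ι) {M : Type u} [AddCommGroup M]
    [Module R M] [Module.Finite R M] (f : M →ₗ[R] E) :
    ∃ n, LinearMap.range f ≤ torsionBySet R E ((maximalIdeal R ^ n : Ideal R) : Set R) := by
  obtain ⟨S, hS⟩ := Module.Finite.fg_top (R := R) (M := M)
  choose n hn using hE.exists_mem_torsionBySet_maximalIdeal_pow
  refine ⟨S.sup fun x => n (f x), ?_⟩
  rw [LinearMap.range_eq_map, ← hS, map_span_le]
  exact fun x hx => torsionBySet_ideal_antitone
    (Ideal.pow_le_pow_right (Finset.le_sup (f := fun x => n (f x)) hx)) (hn (f x))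

theorem iInf_annihilator_eq_iInf_annihilator_quotient (hE : IsInjectiveHull R E ι)
    (hR : IsApproximatelyGorenstein R) {α : Selection R}
    (hα : IsPreradical (artinianModules R) α) :
    (⨅ (M : Type u) (_ : AddCommGroup M) (_ : Module R M) (_ : IsFiniteLength R M),
      (α M).annihilator) =
    ⨅ (I : Ideal R) (_ : IsFiniteLength R (R ⧸ I)), (α (R ⧸ I)).annihilator := by
  refine le_antisymm (iInf_annihilator_le_iInf_annihilator_quotient α)
    (le_iInf fun M => le_iInf fun _ => le_iInf fun _ => le_iInf fun hM r hr =>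
      hE.mem_annihilator_of_forall_smul_apply fun f x hx => ?_)
  obtain ⟨_, hMA⟩ := isFiniteLength_iff_isNoetherian_isArtinian.mp hM
  obtain ⟨n, hn⟩ := hE.exists_maximalIdeal_pow_range_le f
  obtain ⟨I, hIn, hIm, hirr⟩ := hR n
  obtain ⟨e, rfl⟩ := hE.exists_torsionOf_eq_of_infIrred hIm hirr
  have hfl := hIm.isFiniteLength
  have hfe (y : M) : f y ∈ R ∙ e := hE.torsionBySet_torsionOf_eq_span_singleton hfl ▸
    torsionBySet_ideal_antitone hIn (hn ⟨y, rfl⟩)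
  let φ := Ideal.quotTorsionOfEquivSpanSingleton R E e
  have hx' : φ.symm (f.codRestrict _ hfe x) ∈ α (R ⧸ torsionOf R E e) :=
    hα.apply_mem hMA (isFiniteLength_iff_isNoetherian_isArtinian.mp hfl).2
      (φ.symm.toLinearMap ∘ₗ f.codRestrict _ hfe) hx
  have hr' := mem_annihilator.mp ((mem_iInf _).mp ((mem_iInf _).mp hr (torsionOf R E e)) hfl) _ hx'
  rw [← map_smul, φ.symm.map_eq_zero_iff] at hr'
  exact congrArg Subtype.val hr'

end IsInjectiveHull

end ApproximatelyGorenstein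

section Closure

variable {R : Type u} [CommRing R]

/-- Residuality of an operation `e` on the pairs `L ⊆ M` with `M` in `𝓜`: along a surjection, `e`
of the kernel is the preimage of `e` of zero. -/
def IsResidual (𝓜 : ModuleClass R) (e : PairOperation R) : Prop :=
  ∀ (M P : Type u) [AddCommGroup M] [Module R M] [AddCommGroup P] [Module R P],
    𝓜 M → 𝓜 P → ∀ q : M →ₗ[R] P, Function.Surjective q →
      e M (LinearMap.ker q) = (e P ⊥).comap q

variable {α : Selection R} {cl : PairOperation R}

theorem annihilator_eq_colon_of_represents (hcl : IsResidual (artinianModulesAndRing R) cl)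
    (hα : Represents (artinianModules R) α cl) (I : Ideal R) [hI : IsArtinian R (R ⧸ I)] :
    (α (R ⧸ I)).annihilator = I.colon (cl R I : Set R) := by
  have hres := hcl R (R ⧸ I) (.inr ⟨.refl R R⟩) (.inl hI) I.mkQ I.mkQ_surjective
  rw [ker_mkQ] at hres
  rw [hα _ hI, ← annihilator_map_mkQ_eq_colon, hres,
    map_comap_eq_of_surjective I.mkQ_surjective]

theorem iInf_annihilator_eq_iInf_colon [IsLocalRing R] [IsNoetherianRing R]
    (hcl : IsResidual (artinianModulesAndRing R) cl)
    (hα : Represents (artinianModules R) α cl) (hap : HasMPrimaryApproximation R cl) :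
    (⨅ (I : Ideal R) (_ : IsFiniteLength R (R ⧸ I)), (α (R ⧸ I)).annihilator) =
      ⨅ I : Ideal R, I.colon (cl R I : Set R) := by
  have hcolon (I : Ideal R) (hI : IsFiniteLength R (R ⧸ I)) :
      (α (R ⧸ I)).annihilator = I.colon (cl R I : Set R) := by
    have := (isFiniteLength_iff_isNoetherian_isArtinian.mp hI).2
    exact annihilator_eq_colon_of_represents hcl hα I
  refine le_antisymm (le_iInf fun J => ?_)
    (le_iInf fun I => le_iInf fun hI => (iInf_le _ I).trans (hcolon I hI).ge)
  obtain ⟨S, hS, hJ, hclJ⟩ := hap J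
  calc ⨅ (I : Ideal R) (_ : IsFiniteLength R (R ⧸ I)), (α (R ⧸ I)).annihilator
      ≤ ⨅ I ∈ S, I.colon (cl R J : Set R) := le_iInf₂ fun I hI =>
        (iInf₂_le I (hS I hI).isFiniteLength).trans <|
          (hcolon I (hS I hI).isFiniteLength).le.trans <| Submodule.colon_mono le_rfl <|
            hclJ.trans_le (iInf₂_le I hI)
    _ = J.colon (cl R J : Set R) := by
      simp only [← iInf_colon, ← hJ]

end Closure

section Matlis

namespace IsInjectiveHull

variable {R : Type u} [CommRing R] [IsLocalRing R]
  {E : Type u} [AddCommGroup E] [Module R E] {ι : ResidueField R →ₗ[R] E}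

theorem exists_linearMap_torsionBySet_eq_smul (hE : IsInjectiveHull R E ι) {I : Ideal R}
    (hI : IsFiniteLength R (R ⧸ I)) (f : torsionBySet R E (I : Set R) →ₗ[R] E) :
    ∃ r : R, ∀ e, f e = r • (e : E) := by
  let T := torsionBySet R E (I : Set R)
  let φ : R →ₗ[R] (T →ₗ[R] E) := LinearMap.toSpanSingleton R _ T.subtype
  have hker : LinearMap.ker φ = I := by
    conv_rhs => rw [← hE.annihilator_torsionBySet I]
    ext r
    rw [mem_annihilator, LinearMap.mem_ker, LinearMap.ext_iff, Subtype.forall]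
    rfl
  have hlen : Module.length R (T →ₗ[R] E) = Module.length R (R ⧸ I) := by
    rw [hE.length_linearMap (hE.isFiniteLength_torsionBySet hI), hE.length_torsionBySet hI]
  obtain ⟨_, _⟩ := isFiniteLength_iff_isNoetherian_isArtinian.mp <|
    Module.length_ne_top_iff.mp (hlen.trans_ne (Module.length_ne_top_iff.mpr hI))
  have hsurj : LinearMap.range φ = ⊤ := by
    by_contra hne
    refine (length_lt hne).ne ?_
    rw [hlen, ← φ.quotKerEquivRange.length_eq, hker]
  obtain ⟨r, hr⟩ := LinearMap.range_eq_top.mp hsurj f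
  exact ⟨r, fun e => (LinearMap.congr_fun hr e).symm⟩

variable [IsNoetherianRing R] [IsAdicComplete (maximalIdeal R) R]

theorem exists_end_eq_smul (hE : IsInjectiveHull R E ι) (f : E →ₗ[R] E) :
    ∃ r : R, ∀ e, f e = r • e := by
  have hfl (n : ℕ) : IsFiniteLength R (R ⧸ maximalIdeal R ^ n) :=
    isFiniteLength_quotient_of_maximalIdeal_pow_le le_rfl
  choose a ha using fun n => hE.exists_linearMap_torsionBySet_eq_smul (hfl n)
    (f ∘ₗ (torsionBySet R E ((maximalIdeal R ^ n : Ideal R) : Set R)).subtype)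
  have hfa {n e} (he : e ∈ torsionBySet R E ((maximalIdeal R ^ n : Ideal R) : Set R)) :
      f e = a n • e := ha n ⟨e, he⟩
  obtain ⟨r, hr⟩ := IsPrecomplete.prec (I := maximalIdeal R) (M := R) inferInstance (f := a) <| by
    intro m n hmn
    rw [SModEq.sub_mem, smul_eq_mul, Ideal.mul_top, ← hE.annihilator_torsionBySet (_ ^ m)]
    refine mem_annihilator.mpr fun e he => ?_
    rw [sub_smul, ← hfa he, ← hfa (torsionBySet_ideal_antitone (Ideal.pow_le_pow_right hmn) he),
      sub_self]
  refine ⟨r, fun e => ?_⟩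
  obtain ⟨n, hn⟩ := hE.exists_mem_torsionBySet_maximalIdeal_pow e
  have hrn := hr n
  rw [SModEq.sub_mem, smul_eq_mul, Ideal.mul_top] at hrn
  rw [hfa hn, ← sub_eq_zero, ← sub_smul, mem_torsionBySet_ideal_iff.mp hn _ hrn]

theorem torsionBySet_annihilator (hE : IsInjectiveHull R E ι) (N : Submodule R E) :
    torsionBySet R E (N.annihilator : Set R) = N := by
  refine le_antisymm (fun e he => ?_) fun e he => mem_torsionBySet_ideal_iff.mpr fun r hr =>
    mem_annihilator.mp hr e he
  by_contra heN
  obtain ⟨g, hg⟩ := hE.exists_linearMap_apply_ne_zero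
    (mt (Submodule.Quotient.mk_eq_zero N).mp heN)
  obtain ⟨r, hr⟩ := hE.exists_end_eq_smul (g ∘ₗ N.mkQ)
  have hrN : r ∈ N.annihilator := mem_annihilator.mpr fun x hx => by
    rw [← hr, LinearMap.comp_apply, mkQ_apply, (Submodule.Quotient.mk_eq_zero N).mpr hx, map_zero]
  exact hg ((hr e).trans (mem_torsionBySet_ideal_iff.mp he r hrN))

theorem torsionBySet_iInf (hE : IsInjectiveHull R E ι) {ι' : Sort*} (b : ι' → Ideal R) :
    torsionBySet R E ((⨅ i, b i : Ideal R) : Set R) = ⨆ i, torsionBySet R E (b i : Set R) := by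
  conv_rhs => rw [← hE.torsionBySet_annihilator (⨆ i, _)]
  simp only [annihilator_iSup, hE.annihilator_torsionBySet]

-- Chevalley's theorem: dually, a finitely generated submodule of the union of the increasing chain
-- of the `b i`-torsion submodules of `E` lies in one of them.
theorem exists_le_sup_maximalIdeal_pow (hE : IsInjectiveHull R E ι) {b : ℕ → Ideal R}
    (hb : Antitone b) (n : ℕ) : ∃ N, b N ≤ (⨅ i, b i) ⊔ maximalIdeal R ^ n := by
  set J := (⨅ i, b i) ⊔ maximalIdeal R ^ n
  obtain ⟨_, _⟩ := isFiniteLength_iff_isNoetherian_isArtinian.mp <|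
    hE.isFiniteLength_torsionBySet <|
      isFiniteLength_quotient_of_maximalIdeal_pow_le (le_sup_right : _ ≤ J)
  have hfg : (torsionBySet R E (J : Set R)).FG := Module.Finite.iff_fg.mp inferInstance
  have hle : torsionBySet R E (J : Set R) ≤ ⨆ i, torsionBySet R E (b i : Set R) := by
    rw [← hE.torsionBySet_iInf]
    exact torsionBySet_ideal_antitone le_sup_left
  obtain ⟨s, hs⟩ := CompleteLattice.IsCompactElement.exists_finset_of_le_iSup _
    ((fg_iff_compact _).mp hfg) _ hle
  have hN := hs.trans <| iSup₂_le fun i hi =>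
    torsionBySet_ideal_antitone (hb (s.le_sup (f := id) hi))
  refine ⟨s.sup id, ?_⟩
  rw [← hE.annihilator_torsionBySet (b _), ← hE.annihilator_torsionBySet J]
  exact annihilator_mono hN

end IsInjectiveHull

end Matlis

section LocallyCyclic

variable {R : Type u} [CommRing R] {E : Type u} [AddCommGroup E] [Module R E]

/-- Any two elements of the submodule `N` lie in a common cyclic submodule of `N`. -/
def IsLocallyCyclic (N : Submodule R E) : Prop :=
  ∀ x ∈ N, ∀ y ∈ N, ∃ z ∈ N, x ∈ R ∙ z ∧ y ∈ R ∙ z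

theorem IsLocallyCyclic.exists_le_span_singleton {N : Submodule R E} (hN : IsLocallyCyclic N)
    {L : Submodule R E} (hL : L.FG) (hLN : L ≤ N) : ∃ z ∈ N, L ≤ R ∙ z := by
  induction L, hL using fg_induction with
  | singleton x => exact ⟨x, hLN (mem_span_singleton_self x), le_rfl⟩
  | sup L₁ L₂ _ _ h₁ h₂ =>
    obtain ⟨z₁, hz₁, hL₁⟩ := h₁ (le_sup_left.trans hLN)
    obtain ⟨z₂, hz₂, hL₂⟩ := h₂ (le_sup_right.trans hLN)
    obtain ⟨z, hz, hz₁z, hz₂z⟩ := hN z₁ hz₁ z₂ hz₂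
    exact ⟨z, hz, sup_le (hL₁.trans ((span_singleton_le_iff_mem _ _).mpr hz₁z))
      (hL₂.trans ((span_singleton_le_iff_mem _ _).mpr hz₂z))⟩

theorem isLocallyCyclic_iSup_span_singleton {w : ℕ → E} (hw : Monotone fun n => R ∙ w n) :
    IsLocallyCyclic (⨆ n, R ∙ w n) := by
  intro x hx y hy
  obtain ⟨m, hm⟩ := (mem_iSup_of_directed _ hw.directed_le).mp hx
  obtain ⟨n, hn⟩ := (mem_iSup_of_directed _ hw.directed_le).mp hy
  exact ⟨w (max m n), mem_iSup_of_mem (max m n) (mem_span_singleton_self _),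
    hw (le_max_left m n) hm, hw (le_max_right m n) hn⟩

namespace IsInjectiveHull

variable [IsLocalRing R] {ι : ResidueField R →ₗ[R] E}

theorem infIrred_torsionOf (hE : IsInjectiveHull R E ι) {e : E} (he : e ≠ 0) :
    InfIrred (torsionOf R E e) := by
  have hsocle {d : Ideal R} (hd : torsionOf R E e < d) : ∃ r ∈ d, r • e = ι 1 := by
    obtain ⟨r, hr, hre⟩ := SetLike.exists_of_lt hd
    exact hE.map_one_mem (N := Submodule.map (LinearMap.toSpanSingleton R E e) d) <|
      (Submodule.ne_bot_iff _).mpr ⟨r • e, mem_map_of_mem hr, hre⟩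
  refine ⟨fun h => he ((Ideal.torsionOf_eq_top_iff R e).mp h.eq_top), fun b c hbc => ?_⟩
  by_contra! hne
  obtain ⟨r, hr, hre⟩ := hsocle ((hbc ▸ inf_le_left : _ ≤ b).lt_of_ne hne.1.symm)
  obtain ⟨s, hs, hse⟩ := hsocle ((hbc ▸ inf_le_right : _ ≤ c).lt_of_ne hne.2.symm)
  have hrs : r - s ∈ b ⊓ c := by
    rw [hbc, Ideal.mem_torsionOf_iff, sub_smul, hre, hse, sub_self]
  have hr0 : r ∈ b ⊓ c := ⟨hr, sub_add_cancel r s ▸ c.add_mem hrs.2 hs⟩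
  rw [hbc, Ideal.mem_torsionOf_iff, hre] at hr0
  exact hE.map_one_ne_zero hr0

theorem isApproximatelyGorenstein [IsNoetherianRing R] (hE : IsInjectiveHull R E ι)
    (h : IsLocallyCyclic (⊤ : Submodule R E)) : IsApproximatelyGorenstein R := by
  intro n
  set Z := torsionBySet R E ((maximalIdeal R ^ (n + 1) : Ideal R) : Set R)
  obtain ⟨_, -⟩ := isFiniteLength_iff_isNoetherian_isArtinian.mp <|
    hE.isFiniteLength_torsionBySet <|
      isFiniteLength_quotient_of_maximalIdeal_pow_le (le_refl (maximalIdeal R ^ (n + 1)))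
  obtain ⟨e, -, hZe⟩ := h.exists_le_span_singleton (L := Z) (Module.Finite.iff_fg.mp inferInstance)
    le_top
  have he : e ≠ 0 := by
    rintro rfl
    have hZ : ι 1 ∈ Z := mem_torsionBySet_ideal_iff.mpr fun a ha =>
      hE.torsionOf_map_one.ge (Ideal.pow_le_self n.succ_ne_zero ha)
    exact hE.map_one_ne_zero (by simpa using hZe hZ)
  have hirr := hE.infIrred_torsionOf he
  obtain ⟨k, hk⟩ := hE.exists_mem_torsionBySet_maximalIdeal_pow e
  refine ⟨torsionOf R E e, ?_, isMPrimary_of_maximalIdeal_pow_le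
    (mem_torsionBySet_ideal_iff.mp hk) fun htop => hirr.1 (htop ▸ isMax_top), hirr⟩
  calc torsionOf R E e ≤ Z.annihilator := fun r hr => mem_annihilator.mpr fun z hz => by
        obtain ⟨c, rfl⟩ := mem_span_singleton.mp (hZe hz)
        rw [smul_comm, (Ideal.mem_torsionOf_iff e r).mp hr, smul_zero]
    _ = maximalIdeal R ^ (n + 1) := hE.annihilator_torsionBySet _
    _ ≤ maximalIdeal R ^ n := Ideal.pow_le_pow_right n.le_succ

variable [IsNoetherianRing R]

theorem isLocallyCyclic_torsionBySet_of_colon_le (hE : IsInjectiveHull R E ι) {J : Ideal R}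
    (h : ∀ n, ∃ a b, (J ⊔ Ideal.span {a}).colon {b} ≤ J ⊔ maximalIdeal R ^ n ∧
      (J ⊔ Ideal.span {b}).colon {a} ≤ J ⊔ maximalIdeal R ^ n) :
    IsLocallyCyclic (torsionBySet R E (J : Set R)) := by
  have := hE.injective_module
  intro e₁ he₁ e₂ he₂
  obtain ⟨n₁, hn₁⟩ := hE.exists_mem_torsionBySet_maximalIdeal_pow e₁
  obtain ⟨n₂, hn₂⟩ := hE.exists_mem_torsionBySet_maximalIdeal_pow e₂
  obtain ⟨a, b, hab, hba⟩ := h (max n₁ n₂)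
  have htorsion {e : E} {k : ℕ} (hk : k ≤ max n₁ n₂) (he : e ∈ torsionBySet R E (J : Set R))
      (hke : e ∈ torsionBySet R E ((maximalIdeal R ^ k : Ideal R) : Set R)) :
      J ⊔ maximalIdeal R ^ max n₁ n₂ ≤ torsionOf R E e :=
    sup_le (mem_torsionBySet_ideal_iff.mp he) <|
      (Ideal.pow_le_pow_right hk).trans (mem_torsionBySet_ideal_iff.mp hke)
  obtain ⟨z₁, hz₁, hbz₁⟩ := exists_mem_torsionBySet_smul_eq <|
    hab.trans (htorsion (le_max_left _ _) he₁ hn₁)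
  obtain ⟨z₂, hz₂, haz₂⟩ := exists_mem_torsionBySet_smul_eq <|
    hba.trans (htorsion (le_max_right _ _) he₂ hn₂)
  rw [torsionBySet_ideal_sup, mem_inf, torsionBySet_ideal_span_singleton_eq, mem_torsionBy_iff]
    at hz₁ hz₂
  refine ⟨z₁ + z₂, add_mem hz₁.1 hz₂.1, mem_span_singleton.mpr ⟨b, ?_⟩,
    mem_span_singleton.mpr ⟨a, ?_⟩⟩
  · rw [smul_add, hbz₁, hz₂.2, add_zero]
  · rw [smul_add, haz₂, hz₁.2, zero_add]

end IsInjectiveHull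

theorem torsionBySet_ideal_bot : torsionBySet R E ((⊥ : Ideal R) : Set R) = ⊤ :=
  eq_top_iff.mpr fun e _ => mem_torsionBySet_ideal_iff.mpr fun a ha => by
    rw [(Submodule.mem_bot R).mp ha, zero_smul]

theorem dvd_of_pow_dvd_mul_pow {x y : R} (hx : IsSMulRegular R x) (h : ∀ r, x ∣ r * y → x ∣ r)
    {m n : ℕ} {r : R} (hr : x ^ n ∣ r * y ^ m) : x ^ n ∣ r := by
  have hm : ∀ r, x ∣ r * y ^ m → x ∣ r := by
    clear hr
    induction m with
    | zero => simp
    | succ m ih => exact fun r hr => h r (ih _ (by rwa [mul_assoc, ← pow_succ']))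
  induction n generalizing r with
  | zero => simp
  | succ n ih =>
    obtain ⟨d, rfl⟩ := hm r ((dvd_pow_self x n.succ_ne_zero).trans hr)
    rw [pow_succ', mul_assoc] at hr
    obtain ⟨c, hc⟩ := hr
    rw [pow_succ']
    exact mul_dvd_mul_left x (ih ⟨c, hx (by simpa only [smul_eq_mul, mul_assoc] using hc)⟩)

theorem dvd_of_dvd_mul_of_isSMulRegular {x y r : R} (hy : IsSMulRegular (QuotSMulTop x R) y)
    (hr : x ∣ r * y) : x ∣ r := by
  obtain ⟨c, hc⟩ := hr
  obtain ⟨d, -, hd⟩ := (isSMulRegular_quotient_iff_mem_of_smul_mem _ y).mp hy r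
    ⟨c, trivial, by simp [← hc, mul_comm]⟩
  exact ⟨d, hd.symm⟩

theorem colon_pow_le_of_isRegular {x y : R} (hxy : RingTheory.Sequence.IsRegular R [x, y])
    (m n : ℕ) : (Ideal.span {x ^ n}).colon {y ^ m} ≤ Ideal.span {x ^ n} := by
  obtain ⟨hx, hy⟩ := (RingTheory.Sequence.isWeaklyRegular_cons_iff ..).mp hxy.toIsWeaklyRegular
  rw [RingTheory.Sequence.isWeaklyRegular_singleton_iff] at hy
  intro r hr
  rw [Submodule.mem_colon_singleton, smul_eq_mul, Ideal.mem_span_singleton] at hr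
  exact Ideal.mem_span_singleton.mpr <|
    dvd_of_pow_dvd_mul_pow hx (fun _ => dvd_of_dvd_mul_of_isSMulRegular hy) hr

theorem IsInjectiveHull.isLocallyCyclic_of_depthAtLeastTwo [IsLocalRing R] [IsNoetherianRing R]
    {ι : ResidueField R →ₗ[R] E} (hE : IsInjectiveHull R E ι) (h : DepthAtLeastTwo R) :
    IsLocallyCyclic (⊤ : Submodule R E) := by
  obtain ⟨x, hx, y, hy, hxy⟩ := h
  have hyx := isRegular_of_perm hxy (List.Perm.swap y x [])
  have hspan {z : R} (hz : z ∈ maximalIdeal R) (n : ℕ) :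
      Ideal.span {z ^ n} ≤ maximalIdeal R ^ n :=
    (Ideal.span_singleton_le_iff_mem _).mpr (Ideal.pow_mem_pow hz n)
  have hbot := hE.isLocallyCyclic_torsionBySet_of_colon_le (J := ⊥) fun n => ⟨x ^ n, y ^ n, by
    rw [bot_sup_eq, bot_sup_eq, bot_sup_eq]
    exact ⟨(colon_pow_le_of_isRegular hxy n n).trans (hspan hx n),
      (colon_pow_le_of_isRegular hyx n n).trans (hspan hy n)⟩⟩
  rwa [torsionBySet_ideal_bot] at hbot

end LocallyCyclic

section Domain

variable {R : Type u} [CommRing R]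

theorem colon_singleton_le_of_notMem {P : Ideal R} [P.IsPrime] {x : R} (hx : x ∉ P) :
    P.colon {x} ≤ P := fun _ hr =>
  (Ideal.IsPrime.mem_or_mem inferInstance (mem_colon_singleton.mp hr)).resolve_right hx

theorem exists_ringHom_localRing {P Q : Ideal R} [IsNoetherianRing R] [P.IsPrime] [Q.IsPrime]
    (hPQ : P ≤ Q) : ∃ (L : Type u) (_ : CommRing L) (_ : IsLocalRing L) (_ : IsNoetherianRing L)
      (f : R →+* L), RingHom.ker f = P ∧ ∀ r, IsUnit (f r) ↔ r ∉ Q := by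
  let q := Q.map (Ideal.Quotient.mk P)
  have hq : q.IsPrime := Ideal.map_isPrime_of_surjective Ideal.Quotient.mk_surjective
    (by rwa [Ideal.mk_ker])
  let L := Localization.AtPrime q
  refine ⟨L, inferInstance, inferInstance,
    IsLocalization.isNoetherianRing q.primeCompl L inferInstance,
    (algebraMap (R ⧸ P) L).comp (Ideal.Quotient.mk P), ?_, fun r => ?_⟩
  · rw [← RingHom.comap_ker, (RingHom.injective_iff_ker_eq_bot _).mp
      (IsLocalization.injective L q.primeCompl_le_nonZeroDivisors), ← RingHom.ker_eq_comap_bot,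
      Ideal.mk_ker]
  · rw [RingHom.comp_apply, IsLocalization.AtPrime.isUnit_to_map_iff L q, Ideal.mem_primeCompl_iff,
      Ideal.mem_quotient_iff_mem hPQ]

theorem exists_notMem_forall_mem_or_incomparable [IsNoetherianRing R] (P : Ideal R) [P.IsPrime] :
    (∃ x ∉ P, ∀ Q : Ideal R, Q.IsPrime → P < Q → x ∈ Q) ∨
      ∃ Q Q' : Ideal R, Q.IsPrime ∧ Q'.IsPrime ∧ P ≤ Q ∧ P ≤ Q' ∧ ¬Q ≤ Q' ∧ ¬Q' ≤ Q := by
  have : WellFoundedLT (PrimeSpectrum R) := StrictMono.wellFoundedLT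
    (f := fun Q => Q.asIdeal.height) fun _ _ h => Ideal.height_strict_mono_of_isPrime h
  by_cases! hne : ∃ Q : PrimeSpectrum R, P < Q.asIdeal
  · obtain ⟨Q, hPQ, hQmin⟩ := exists_minimal_of_wellFoundedLT _ hne
    by_cases! hmin : ∀ Q' : Ideal R, Q'.IsPrime → P < Q' → Q.asIdeal ≤ Q'
    · obtain ⟨x, hxQ, hxP⟩ := SetLike.exists_of_lt hPQ
      exact .inl ⟨x, hxP, fun Q' hQ' hPQ' => hmin Q' hQ' hPQ' hxQ⟩
    · obtain ⟨Q', hQ', hPQ', hQQ'⟩ := hmin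
      exact .inr ⟨Q.asIdeal, Q', Q.isPrime, hQ', hPQ.le, hPQ'.le, hQQ',
        fun hle => hQQ' (hQmin (y := ⟨Q', hQ'⟩) hPQ' hle)⟩
  · exact .inl ⟨1, (Ideal.ne_top_iff_one P).mp Ideal.IsPrime.ne_top',
      fun Q hQ hPQ => absurd hPQ (hne ⟨Q, hQ⟩)⟩

variable [IsLocalRing R] [IsNoetherianRing R] [IsAdicComplete (maximalIdeal R) R]
  {E : Type u} [AddCommGroup E] [Module R E] {ι : ResidueField R →ₗ[R] E}

namespace IsInjectiveHull

theorem exists_comap_maximalIdeal_pow_le (hE : IsInjectiveHull R E ι) {L : Type*} [CommRing L]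
    [IsLocalRing L] [IsNoetherianRing L] (f : R →+* L) (n : ℕ) :
    ∃ N, (maximalIdeal L ^ N).comap f ≤ RingHom.ker f ⊔ maximalIdeal R ^ n := by
  have hker : ⨅ N : ℕ, (maximalIdeal L ^ N).comap f = RingHom.ker f := by
    rw [← Ideal.comap_iInf, Ideal.iInf_pow_eq_bot_of_isLocalRing _ Ideal.IsPrime.ne_top',
      RingHom.ker_eq_comap_bot]
  rw [← hker]
  exact hE.exists_le_sup_maximalIdeal_pow
    (fun _ _ h => Ideal.comap_mono (Ideal.pow_le_pow_right h)) n

theorem exists_forall_colon_pow_le (hE : IsInjectiveHull R E ι) {P Q : Ideal R} [P.IsPrime]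
    [Q.IsPrime] (hPQ : P ≤ Q) {x y : R} (hx : x ∈ Q) (hy : y ∉ Q) (n : ℕ) :
    ∃ N, ∀ k ≥ N, (P ⊔ Ideal.span {x ^ k}).colon {y ^ k} ≤ P ⊔ maximalIdeal R ^ n := by
  obtain ⟨L, _, _, _, f, rfl, hf⟩ := exists_ringHom_localRing hPQ
  obtain ⟨N, hN⟩ := hE.exists_comap_maximalIdeal_pow_le f n
  refine ⟨N, fun k hk => le_trans (fun r hr => ?_) hN⟩
  have hle : RingHom.ker f ⊔ Ideal.span {x ^ k} ≤ (maximalIdeal L ^ N).comap f := by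
    refine sup_le (Ideal.comap_mono bot_le) ((Ideal.span_singleton_le_iff_mem _).mpr ?_)
    rw [Ideal.mem_comap, map_pow]
    refine Ideal.pow_le_pow_right hk (Ideal.pow_mem_pow ?_ k)
    rwa [mem_maximalIdeal, mem_nonunits_iff, hf, not_not]
  have hry := hle (mem_colon_singleton.mp hr)
  rwa [Ideal.mem_comap, smul_eq_mul, map_mul, map_pow,
    Ideal.mul_unit_mem_iff_mem _ (((hf y).mpr hy).pow k)] at hry

theorem isLocallyCyclic_torsionBySet_of_incomparable (hE : IsInjectiveHull R E ι)
    {P Q Q' : Ideal R} [P.IsPrime] [Q.IsPrime] [Q'.IsPrime] (hPQ : P ≤ Q) (hPQ' : P ≤ Q')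
    (hQQ' : ¬Q ≤ Q') (hQ'Q : ¬Q' ≤ Q) : IsLocallyCyclic (torsionBySet R E (P : Set R)) := by
  obtain ⟨x, hxQ, hxQ'⟩ := SetLike.not_le_iff_exists.mp hQQ'
  obtain ⟨y, hyQ', hyQ⟩ := SetLike.not_le_iff_exists.mp hQ'Q
  refine hE.isLocallyCyclic_torsionBySet_of_colon_le fun n => ?_
  obtain ⟨N, hN⟩ := hE.exists_forall_colon_pow_le hPQ hxQ hyQ n
  obtain ⟨N', hN'⟩ := hE.exists_forall_colon_pow_le hPQ' hyQ' hxQ' n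
  exact ⟨x ^ max N N', y ^ max N N', hN _ (le_max_left _ _), hN' _ (le_max_right _ _)⟩

theorem iSup_span_singleton_eq_torsionBySet (hE : IsInjectiveHull R E ι) {P : Ideal R} {x : R}
    (hx : ∀ a ∉ P, x ∈ (P ⊔ Ideal.span {a}).radical) {w : ℕ → E} (hw : ∀ n, x ^ n • w n = ι 1)
    (hwP : ∀ n, w n ∈ torsionBySet R E (P : Set R)) :
    ⨆ n, R ∙ w n = torsionBySet R E (P : Set R) := by
  have hann : (⨆ n, R ∙ w n).annihilator = P := by
    refine le_antisymm (fun a ha => ?_) ?_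
    · by_contra haP
      obtain ⟨n, hn⟩ := hx a haP
      have hle : P ⊔ Ideal.span {a} ≤ torsionOf R E (w n) :=
        sup_le (mem_torsionBySet_ideal_iff.mp (hwP n)) <| (Ideal.span_singleton_le_iff_mem _).mpr <|
          mem_annihilator.mp ha _ (mem_iSup_of_mem n (mem_span_singleton_self _))
      exact hE.map_one_ne_zero ((hw n).symm.trans (hle hn))
    · rw [← hE.annihilator_torsionBySet P]
      exact annihilator_mono (iSup_le fun n => (span_singleton_le_iff_mem _ _).mpr
        (by simpa using hwP n))
  rw [← hE.torsionBySet_annihilator (⨆ n, R ∙ w n), hann]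

theorem isLocallyCyclic_torsionBySet_of_forall_mem (hE : IsInjectiveHull R E ι) {P : Ideal R}
    [P.IsPrime] {x : R} (hxP : x ∉ P) (hx : ∀ Q : Ideal R, Q.IsPrime → P < Q → x ∈ Q) :
    IsLocallyCyclic (torsionBySet R E (P : Set R)) := by
  have := hE.injective_module
  have hdiv (e : torsionBySet R E (P : Set R)) :
      ∃ z ∈ torsionBySet R E (P : Set R), x • z = e :=
    exists_mem_torsionBySet_smul_eq <|
      (colon_singleton_le_of_notMem hxP).trans (mem_torsionBySet_ideal_iff.mp e.2)
  choose d hdP hd using hdiv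
  have hι : ι 1 ∈ torsionBySet R E (P : Set R) := mem_torsionBySet_ideal_iff.mpr <|
    (le_maximalIdeal Ideal.IsPrime.ne_top').trans hE.torsionOf_map_one.ge
  let w (n : ℕ) : torsionBySet R E (P : Set R) := (fun e => ⟨d e, hdP e⟩)^[n] ⟨ι 1, hι⟩
  have hw (n : ℕ) : x • (w (n + 1) : E) = w n := by
    simp only [w, Function.iterate_succ_apply', hd]
  have hwpow (n : ℕ) : x ^ n • (w n : E) = ι 1 := by
    induction n with
    | zero => rw [pow_zero, one_smul]; rfl
    | succ n ih => rw [pow_succ, mul_smul, hw, ih]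
  have hrad (a : R) (ha : a ∉ P) : x ∈ (P ⊔ Ideal.span {a}).radical := by
    rw [Ideal.radical_eq_sInf, Ideal.mem_sInf]
    rintro Q ⟨hle, hQ⟩
    exact hx Q hQ <| (le_sup_left.trans hle).lt_of_not_ge fun hQP =>
      ha (hQP (hle (Ideal.mem_sup_right (Ideal.mem_span_singleton_self a))))
  rw [← hE.iSup_span_singleton_eq_torsionBySet hrad hwpow fun n => (w n).2]
  exact isLocallyCyclic_iSup_span_singleton <| monotone_nat_of_le_succ fun n =>
    (span_singleton_le_iff_mem _ _).mpr (mem_span_singleton.mpr ⟨x, hw n⟩)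

theorem isLocallyCyclic_torsionBySet (hE : IsInjectiveHull R E ι) (P : Ideal R) [P.IsPrime] :
    IsLocallyCyclic (torsionBySet R E (P : Set R)) := by
  rcases exists_notMem_forall_mem_or_incomparable P with
    ⟨x, hxP, hx⟩ | ⟨Q, Q', _, _, hPQ, hPQ', hQQ', hQ'Q⟩
  · exact hE.isLocallyCyclic_torsionBySet_of_forall_mem hxP hx
  · exact hE.isLocallyCyclic_torsionBySet_of_incomparable hPQ hPQ' hQQ' hQ'Q

end IsInjectiveHull

end Domain

section Reduced

variable {R : Type u} [CommRing R]

theorem exists_mem_finset_inf_colon_le {P : Ideal R} [P.IsPrime] {T : Finset (Ideal R)}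
    (hT : ∀ Q ∈ T, ¬Q ≤ P) : ∃ s ∈ T.inf id, P.colon {s} ≤ P := by
  obtain ⟨s, hsT, hsP⟩ := SetLike.not_le_iff_exists.mp fun hle : T.inf id ≤ P =>
    have ⟨Q, hQ, hQP⟩ := (Ideal.IsPrime.inf_le' inferInstance).mp hle
    hT Q hQ hQP
  exact ⟨s, hsT, colon_singleton_le_of_notMem hsP⟩

theorem exists_mem_colon_finset_inf_le {I : Ideal R} {T : Finset (Ideal R)}
    (hT : ∀ Q ∈ T, Q.IsPrime) (hI : ∀ Q ∈ T, ¬I ≤ Q) :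
    ∃ t ∈ I, (T.inf id).colon {t} ≤ T.inf id := by
  obtain ⟨t, htI, ht⟩ := Set.not_subset.mp fun hle : (I : Set R) ⊆ ⋃ Q ∈ (T : Set (Ideal R)), Q =>
    have ⟨Q, hQ, hIQ⟩ := (Ideal.subset_union_prime ⊥ ⊥ fun Q hQ _ _ => hT Q hQ).mp hle
    hI Q hQ hIQ
  simp only [Set.mem_iUnion, not_exists] at ht
  refine ⟨t, htI, Finset.le_inf fun Q hQ => ?_⟩
  have := hT Q hQ
  exact (colon_mono (Finset.inf_le hQ) subset_rfl).trans
    (colon_singleton_le_of_notMem (P := Q) (ht Q hQ))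

variable [IsLocalRing R] [IsNoetherianRing R] [IsAdicComplete (maximalIdeal R) R]
  {E : Type u} [AddCommGroup E] [Module R E] {ι : ResidueField R →ₗ[R] E}

namespace IsInjectiveHull

theorem torsionBySet_inf (hE : IsInjectiveHull R E ι) (J K : Ideal R) :
    torsionBySet R E ((J ⊓ K : Ideal R) : Set R) =
      torsionBySet R E (J : Set R) ⊔ torsionBySet R E (K : Set R) := by
  rw [inf_eq_iInf, hE.torsionBySet_iInf, iSup_bool_eq, cond_true, cond_false]

theorem isLocallyCyclic_torsionBySet_inf (hE : IsInjectiveHull R E ι) {J K : Ideal R}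
    (hJ : IsLocallyCyclic (torsionBySet R E (J : Set R)))
    (hK : IsLocallyCyclic (torsionBySet R E (K : Set R)))
    (hKJ : ∃ s ∈ K, J.colon {s} ≤ J) (hJK : ∃ t ∈ J, K.colon {t} ≤ K) :
    IsLocallyCyclic (torsionBySet R E ((J ⊓ K : Ideal R) : Set R)) := by
  have := hE.injective_module
  obtain ⟨s, hsK, hs⟩ := hKJ
  obtain ⟨t, htJ, ht⟩ := hJK
  rw [hE.torsionBySet_inf]
  intro x hx y hy
  obtain ⟨x₁, hx₁, x₂, hx₂, rfl⟩ := mem_sup.mp hx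
  obtain ⟨y₁, hy₁, y₂, hy₂, rfl⟩ := mem_sup.mp hy
  obtain ⟨c₁, hc₁, hxc₁, hyc₁⟩ := hJ x₁ hx₁ y₁ hy₁
  obtain ⟨c₂, hc₂, hxc₂, hyc₂⟩ := hK x₂ hx₂ y₂ hy₂
  obtain ⟨z₁, hz₁, rfl⟩ := exists_mem_torsionBySet_smul_eq <|
    hs.trans (mem_torsionBySet_ideal_iff.mp hc₁)
  obtain ⟨z₂, hz₂, rfl⟩ := exists_mem_torsionBySet_smul_eq <|
    ht.trans (mem_torsionBySet_ideal_iff.mp hc₂)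
  have hsz : s • (z₁ + z₂) = s • z₁ := by
    rw [smul_add, mem_torsionBySet_ideal_iff.mp hz₂ s hsK, add_zero]
  have htz : t • (z₁ + z₂) = t • z₂ := by
    rw [smul_add, mem_torsionBySet_ideal_iff.mp hz₁ t htJ, zero_add]
  have hle₁ : R ∙ s • z₁ ≤ R ∙ (z₁ + z₂) := hsz ▸ span_singleton_smul_le R s _
  have hle₂ : R ∙ t • z₂ ≤ R ∙ (z₁ + z₂) := htz ▸ span_singleton_smul_le R t _
  exact ⟨z₁ + z₂, add_mem_sup hz₁ hz₂, add_mem (hle₁ hxc₁) (hle₂ hxc₂),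
    add_mem (hle₁ hyc₁) (hle₂ hyc₂)⟩

theorem isLocallyCyclic_torsionBySet_finset_inf (hE : IsInjectiveHull R E ι)
    {T : Finset (Ideal R)} (hT : ∀ P ∈ T, P.IsPrime)
    (hinc : IsAntichain (· ≤ ·) (T : Set (Ideal R))) :
    IsLocallyCyclic (torsionBySet R E ((T.inf id : Ideal R) : Set R)) := by
  classical
  induction T using Finset.induction_on with
  | empty =>
    intro x hx y hy
    obtain rfl : x = 0 := by simpa using mem_torsionBySet_ideal_iff.mp hx 1 trivial
    obtain rfl : y = 0 := by simpa using mem_torsionBySet_ideal_iff.mp hy 1 trivial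
    exact ⟨0, zero_mem _, zero_mem _, zero_mem _⟩
  | insert P T hPT ih =>
    rw [Finset.inf_insert, id]
    rw [Finset.forall_mem_insert] at hT
    rw [Finset.coe_insert] at hinc
    obtain ⟨hP, hT⟩ := hT
    have hne {Q : Ideal R} (hQ : Q ∈ T) : P ≠ Q := fun h => hPT (h ▸ hQ)
    exact hE.isLocallyCyclic_torsionBySet_inf (hE.isLocallyCyclic_torsionBySet P)
      (ih hT (hinc.subset (Set.subset_insert _ _)))
      (exists_mem_finset_inf_colon_le fun Q hQ => hinc (.inr hQ) (.inl rfl) (hne hQ).symm)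
      (exists_mem_colon_finset_inf_le hT fun Q hQ => hinc (.inl rfl) (.inr hQ) (hne hQ))

theorem isLocallyCyclic_of_isReduced [IsReduced R] (hE : IsInjectiveHull R E ι) :
    IsLocallyCyclic (⊤ : Submodule R E) := by
  have hfin := Ideal.finite_minimalPrimes_of_isNoetherianRing R ⊥
  have hinf : hfin.toFinset.inf id = ⊥ := by
    rw [Finset.inf_id_eq_sInf, hfin.coe_toFinset, Ideal.sInf_minimalPrimes,
      Ideal.radical_bot_of_isReduced]
  rw [← torsionBySet_ideal_bot, ← hinf]
  exact hE.isLocallyCyclic_torsionBySet_finset_inf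
    (fun P hP => (hfin.mem_toFinset.mp hP).1.1)
    (by rw [hfin.coe_toFinset]; exact setOfPred_minimal_antichain _)

end IsInjectiveHull

end Reduced

end TestIdeal

theorem theorem5p5_general {R : Type u} [CommRing R] [IsLocalRing R] [IsNoetherianRing R]
    (E : Type u) [AddCommGroup E] [Module R E] (ι : IsLocalRing.ResidueField R →ₗ[R] E)
    (hE : TestIdeal.IsInjectiveHull R E ι)
    (α : TestIdeal.Selection R)
    (hα : TestIdeal.IsPreradical (TestIdeal.artinianModules R) α) :
    let αf : TestIdeal.Selection R := TestIdeal.finitistic (TestIdeal.artinianModules R) α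
    TestIdeal.artinianModules R E ∧
    TestIdeal.smileDual E α R = (α E).annihilator ∧
    (α E).annihilator =
      (⨅ (M : Type u) (_ : AddCommGroup M) (_ : Module R M) (_ : TestIdeal.artinianModules R M),
        (α M).annihilator) ∧
    (⨅ (M : Type u) (_ : AddCommGroup M) (_ : Module R M) (_ : TestIdeal.artinianModules R M),
        (α M).annihilator) ≤ TestIdeal.smileDual E αf R ∧
    TestIdeal.smileDual E αf R = (αf E).annihilator ∧
    (αf E).annihilator =
      (⨅ (M : Type u) (_ : AddCommGroup M) (_ : Module R M) (_ : IsFiniteLength R M),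
        (α M).annihilator) ∧
    (⨅ (M : Type u) (_ : AddCommGroup M) (_ : Module R M) (_ : IsFiniteLength R M),
        (α M).annihilator) ≤
      (⨅ (I : Ideal R) (_ : IsFiniteLength R (R ⧸ I)), (α (R ⧸ I)).annihilator) ∧
    (TestIdeal.IsApproximatelyGorenstein R →
      (⨅ (M : Type u) (_ : AddCommGroup M) (_ : Module R M) (_ : IsFiniteLength R M),
        (α M).annihilator) =
      (⨅ (I : Ideal R) (_ : IsFiniteLength R (R ⧸ I)), (α (R ⧸ I)).annihilator)) ∧
    (IsAdicComplete (IsLocalRing.maximalIdeal R) R → IsReduced R →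
      TestIdeal.IsApproximatelyGorenstein R) ∧
    (TestIdeal.DepthAtLeastTwo R → TestIdeal.IsApproximatelyGorenstein R) ∧
    (∀ cl : TestIdeal.PairOperation R,
      TestIdeal.IsResidual (TestIdeal.artinianModulesAndRing R) cl →
      TestIdeal.Represents (TestIdeal.artinianModules R) α cl →
      TestIdeal.HasMPrimaryApproximation R cl →
      (⨅ (I : Ideal R) (_ : IsFiniteLength R (R ⧸ I)), (α (R ⧸ I)).annihilator) =
        ⨅ I : Ideal R, I.colon (cl R I : Set R)) := by
  intro αf
  have hA : IsArtinian R E := hE.isArtinian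
  have hRE : IsArtinian R (R →ₗ[R] E) :=
    (LinearMap.ringLmapEquivSelf R R E).isArtinian_iff.mpr hA
  have hαE := hE.annihilator_eq_iInf_annihilator hα hA
  have hαf : TestIdeal.smileDual E αf R = (αf E).annihilator :=
    hα.finitistic.toIsSubmoduleSelector.smileDual_eq_annihilator hRE hA
  have hle : (α E).annihilator ≤ (αf E).annihilator :=
    Submodule.annihilator_mono (hα.finitistic_le hA)
  exact ⟨hA, hα.toIsSubmoduleSelector.smileDual_eq_annihilator hRE hA, hαE,
    hαE.ge.trans (hle.trans hαf.ge), hαf,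
    hE.annihilator_finitistic_eq_iInf_annihilator hα,
    TestIdeal.iInf_annihilator_le_iInf_annihilator_quotient α,
    fun hR => hE.iInf_annihilator_eq_iInf_annihilator_quotient hR hα,
    fun _ _ => hE.isApproximatelyGorenstein hE.isLocallyCyclic_of_isReduced,
    fun hdepth => hE.isApproximatelyGorenstein (hE.isLocallyCyclic_of_depthAtLeastTwo hdepth),
    fun _ hcl hrep hap => TestIdeal.iInf_annihilator_eq_iInf_colon hcl hrep hap⟩

theorem theorem5p5 {R : Type u} [CommRing R] [IsLocalRing R] [IsNoetherianRing R]
    [IsAdicComplete (IsLocalRing.maximalIdeal R) R]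
    (E : Type u) [AddCommGroup E] [Module R E] (ι : IsLocalRing.ResidueField R →ₗ[R] E)
    (hE : TestIdeal.IsInjectiveHull R E ι)
    (α : TestIdeal.Selection R)
    (hα : TestIdeal.IsPreradical (TestIdeal.artinianModules R) α) :
    let αf : TestIdeal.Selection R := TestIdeal.finitistic (TestIdeal.artinianModules R) α
    -- `E` belongs to the category on which `α` is given
    TestIdeal.artinianModules R E ∧
    TestIdeal.smileDual E α R = (α E).annihilator ∧
    (α E).annihilator =
      (⨅ (M : Type u) (_ : AddCommGroup M) (_ : Module R M) (_ : TestIdeal.artinianModules R M),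
        (α M).annihilator) ∧
    (⨅ (M : Type u) (_ : AddCommGroup M) (_ : Module R M) (_ : TestIdeal.artinianModules R M),
        (α M).annihilator) ≤ TestIdeal.smileDual E αf R ∧
    TestIdeal.smileDual E αf R = (αf E).annihilator ∧
    (αf E).annihilator =
      (⨅ (M : Type u) (_ : AddCommGroup M) (_ : Module R M) (_ : IsFiniteLength R M),
        (α M).annihilator) ∧
    (⨅ (M : Type u) (_ : AddCommGroup M) (_ : Module R M) (_ : IsFiniteLength R M),
        (α M).annihilator) ≤
      (⨅ (I : Ideal R) (_ : IsFiniteLength R (R ⧸ I)), (α (R ⧸ I)).annihilator) ∧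
    -- equality for approximately Gorenstein rings, e.g. reduced ones or those of depth at least 2
    (TestIdeal.IsApproximatelyGorenstein R →
      (⨅ (M : Type u) (_ : AddCommGroup M) (_ : Module R M) (_ : IsFiniteLength R M),
        (α M).annihilator) =
      (⨅ (I : Ideal R) (_ : IsFiniteLength R (R ⧸ I)), (α (R ⧸ I)).annihilator)) ∧
    (IsReduced R → TestIdeal.IsApproximatelyGorenstein R) ∧
    (TestIdeal.DepthAtLeastTwo R → TestIdeal.IsApproximatelyGorenstein R) ∧
    -- closure operations on Artinian modules and on all ideals
    (∀ cl : TestIdeal.PairOperation R,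
      TestIdeal.IsResidualClosure (TestIdeal.artinianModulesAndRing R) cl →
      TestIdeal.Represents (TestIdeal.artinianModules R) α cl →
      TestIdeal.HasMPrimaryApproximation R cl →
      (⨅ (I : Ideal R) (_ : IsFiniteLength R (R ⧸ I)), (α (R ⧸ I)).annihilator) =
        ⨅ I : Ideal R, I.colon (cl R I : Set R)) := by
  intro αf
  obtain ⟨hA, h₁, h₂, h₃, h₄, h₅, h₆, h₇, hred, hdepth, hcl⟩ := theorem5p5_general E ι hE α hα
  exact ⟨hA, h₁, h₂, h₃, h₄, h₅, h₆, h₇, hred inferInstance, hdepth,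
    fun cl h => hcl cl h.residual⟩
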